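/- Let $n\ge 3$. A \emph{camera} is a real $3\times 4$ matrix of rank $3$; its \emph{center} is its kernel, viewed as a point of $\mathbb{P}^3$. For real $3\times 4$ matrices $P,Q$ let $\psi(P,Q)\in\mathbb{R}^{3\times 3}$ be the matrix with $$x^T\psi(P,Q)\,y=\det\begin{bmatrix}P&x&0\\ Q&0&y\end{bmatrix}\qquad\text{for all } x,y\in\mathbb{R}^3 .$$ Let $\{F^{ij}\}_{1\le i\neq j\le n}$ be real $3\times 3$ matrices of rank $2$ with $F^{ji}=(F^{ij})^T$. A \emph{solution} to $\{F^{ij}\}$ is a tuple of cameras $P_1,\dots,P_n$ such that, for all $i\ne j$, $F^{ij}$ equals $\psi(P_i,P_j)$ up to a non-zero scalar. The \emph{$i$-th epipole in the $j$-th image} is $e^i_j=\ker F^{ij}$, viewed as a point of $\mathbb{P}^2$. For scalars $\lambda_{ij}=\lambda_{ji}\neq 0$ ($i\neq j$), let $\mathbf{F}_\lambda$ be the symmetric $3n\times 3n$ matrix with $3\times 3$ blocks $\lambda_{ij}F^{ij}$ for $i\neq j$ and zero diagonal blocks. \textbf{Theorem.} \begin{enumerate} \item (Collinear case.) $\{F^{ij}\}$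 has a solution whose centers all lie on a line if and only if there exist non-zero scalars $\lambda_{ij}=\lambda_{ji}$ such that $\mathbf{F}_\lambda$ has rank $4$ and each of its $3\times 3n$ block rows and $3n\times 3$ block columns has rank $2$. \item (Non-collinear case.) Suppose that in each image no three epipoles lie on a line, i.e. for every $j$ and all pairwise distinct $i,k,l\neq j$ the points $e^i_j,e^k_j,e^l_j$ are not contained in a line of $\mathbb{P}^2$. Then $\{F^{ij}\}$ has a solution whose centers do not all lie on a line if and only if there exist non-zero scalars $\lambda_{ij}=\lambda_{ji}$ such that $\mathbf{F}_\lambda$ has rank $6$ and each of its $3\times 3n$ block rows and $3n\times 3$ block columns has rank $3$. \end{enumerate} -/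

import Mathlib

open scoped Matrix

noncomputable section

namespace NView

/-- The `6 × 6` matrix `[P x 0; Q 0 y]`. -/
def pairMatrix (P Q : Matrix (Fin 3) (Fin 4) ℝ) (x y : Fin 3 → ℝ) :
    Matrix (Fin 6) (Fin 6) ℝ :=
  (Matrix.fromBlocks P (Matrix.of fun a => ![x a, 0]) Q (Matrix.of fun a => ![0, y a])).submatrix
    (finSumFinEquiv (m := 3) (n := 3)).symm (finSumFinEquiv (m := 4) (n := 2)).symm

/-- `psi P Q` is the matrix of the bilinear form `(x, y) ↦ det [P x 0; Q 0 y]`,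
see `dotProduct_psi_mulVec`. -/
def psi (P Q : Matrix (Fin 3) (Fin 4) ℝ) : Matrix (Fin 3) (Fin 3) ℝ :=
  Matrix.of fun a b => (pairMatrix P Q (Pi.single a 1) (Pi.single b 1)).det

theorem pairMatrix_eq_updateCol_left (P Q : Matrix (Fin 3) (Fin 4) ℝ) (x x' y : Fin 3 → ℝ) :
    pairMatrix P Q x y =
      (pairMatrix P Q x' y).updateCol 4 ![x 0, x 1, x 2, 0, 0, 0] := by
  ext i j
  fin_cases i <;> fin_cases j <;> rfl

theorem pairMatrix_eq_updateCol_right (P Q : Matrix (Fin 3) (Fin 4) ℝ) (x y y' : Fin 3 → ℝ) :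
    pairMatrix P Q x y =
      (pairMatrix P Q x y').updateCol 5 ![0, 0, 0, y 0, y 1, y 2] := by
  ext i j
  fin_cases i <;> fin_cases j <;> rfl

/-- The determinant `det [P x 0; Q 0 y]` as a bilinear form. -/
def pairForm (P Q : Matrix (Fin 3) (Fin 4) ℝ) :
    (Fin 3 → ℝ) →ₗ[ℝ] (Fin 3 → ℝ) →ₗ[ℝ] ℝ :=
  LinearMap.mk₂ ℝ (fun x y => (pairMatrix P Q x y).det)
    (fun x x' y => by
      rw [pairMatrix_eq_updateCol_left P Q (x + x') 0 y, pairMatrix_eq_updateCol_left P Q x 0 y,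
        pairMatrix_eq_updateCol_left P Q x' 0 y, ← Matrix.det_updateCol_add]
      simp)
    (fun c x y => by
      rw [pairMatrix_eq_updateCol_left P Q (c • x) 0 y, pairMatrix_eq_updateCol_left P Q x 0 y,
        smul_eq_mul, ← Matrix.det_updateCol_smul]
      simp)
    (fun x y y' => by
      rw [pairMatrix_eq_updateCol_right P Q x (y + y') 0,
        pairMatrix_eq_updateCol_right P Q x y 0,
        pairMatrix_eq_updateCol_right P Q x y' 0, ← Matrix.det_updateCol_add]
      simp)
    (fun c x y => by
      rw [pairMatrix_eq_updateCol_right P Q x (c • y) 0,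
        pairMatrix_eq_updateCol_right P Q x y 0,
        smul_eq_mul, ← Matrix.det_updateCol_smul]
      simp)

/-- The defining property of `psi`. -/
theorem dotProduct_psi_mulVec (P Q : Matrix (Fin 3) (Fin 4) ℝ) (x y : Fin 3 → ℝ) :
    x ⬝ᵥ (psi P Q *ᵥ y) = (pairMatrix P Q x y).det := by
  have h : psi P Q = LinearMap.toMatrix₂' ℝ (pairForm P Q) := by
    ext a b
    simp [psi, pairForm, LinearMap.toMatrix₂'_apply]
  rw [h, ← Matrix.toLinearMap₂'_apply', Matrix.toLinearMap₂'_toMatrix']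
  rfl

/-- A camera is a `3 × 4` matrix of full rank. -/
def IsCamera (P : Matrix (Fin 3) (Fin 4) ℝ) : Prop := P.rank = 3

/-- The center of a camera: its kernel, a point of the projective 3-space. -/
def center (P : Matrix (Fin 3) (Fin 4) ℝ) : Submodule ℝ (Fin 4 → ℝ) :=
  LinearMap.ker P.mulVecLin

/-- The projective points `c i` (one-dimensional subspaces of `ℝ^m`) all lie on one projective
line, i.e. in one two-dimensional subspace. -/
def OnALine {ι : Type*} {m : ℕ} (c : ι → Submodule ℝ (Fin m → ℝ)) : Prop :=
  ∃ L : Submodule ℝ (Fin m → ℝ), Module.finrank ℝ L = 2 ∧ ∀ i, c i ≤ L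

/-- `F` is a complete set of fundamental matrices on `n` views: for `i ≠ j` the matrix `F i j` has
rank two and `F j i` is its transpose. The diagonal entries `F i i` play no role. -/
structure IsFundamentalFamily {n : ℕ} (F : Fin n → Fin n → Matrix (Fin 3) (Fin 3) ℝ) : Prop where
  rank_eq : ∀ i j, i ≠ j → (F i j).rank = 2
  transpose_eq : ∀ i j, i ≠ j → (F i j)ᵀ = F j i

/-- The cameras `P i` are a solution to `F`: `F i j = psi (P i) (P j)` up to a non-zero scalar. -/
structure IsSolution {n : ℕ} (F : Fin n → Fin n → Matrix (Fin 3) (Fin 3) ℝ)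
    (P : Fin n → Matrix (Fin 3) (Fin 4) ℝ) : Prop where
  isCamera : ∀ i, IsCamera (P i)
  psi_eq : ∀ i j, i ≠ j → ∃ c : ℝ, c ≠ 0 ∧ F i j = c • psi (P i) (P j)

/-- The `i`-th epipole in the `j`-th image: the kernel of `F i j`, a point of the projective
plane. -/
def epipole {n : ℕ} (F : Fin n → Fin n → Matrix (Fin 3) (Fin 3) ℝ) (i j : Fin n) :
    Submodule ℝ (Fin 3 → ℝ) :=
  LinearMap.ker (F i j).mulVecLin

/-- In each image, no three epipoles (with three different indices) lie on a line. -/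
def NoThreeEpipolesOnALine {n : ℕ} (F : Fin n → Fin n → Matrix (Fin 3) (Fin 3) ℝ) : Prop :=
  ∀ j : Fin n, ∀ k : Fin 3 → Fin n, Function.Injective k → (∀ a, k a ≠ j) →
    ¬ OnALine fun a => epipole F (k a) j

/-- Non-zero scalars `s i j = s j i` for `i ≠ j`. -/
structure IsScaling {n : ℕ} (s : Fin n → Fin n → ℝ) : Prop where
  ne_zero : ∀ i j, i ≠ j → s i j ≠ 0
  symm : ∀ i j, i ≠ j → s i j = s j i

/-- The `n`-view fundamental matrix of the scaled family `s i j • F i j`: a `3n × 3n` matrix with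
zero diagonal blocks. -/
def nViewMatrix {n : ℕ} (s : Fin n → Fin n → ℝ) (F : Fin n → Fin n → Matrix (Fin 3) (Fin 3) ℝ) :
    Matrix (Fin n × Fin 3) (Fin n × Fin 3) ℝ :=
  Matrix.of fun p q => if p.1 = q.1 then 0 else s p.1 q.1 * F p.1 q.1 p.2 q.2

/-- The `i`-th `3 × 3n` block row. -/
def blockRow {n : ℕ} (M : Matrix (Fin n × Fin 3) (Fin n × Fin 3) ℝ) (i : Fin n) :
    Matrix (Fin 3) (Fin n × Fin 3) ℝ :=
  M.submatrix (fun a => (i, a)) id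

/-- The `j`-th `3n × 3` block column. -/
def blockCol {n : ℕ} (M : Matrix (Fin n × Fin 3) (Fin n × Fin 3) ℝ) (j : Fin n) :
    Matrix (Fin n × Fin 3) (Fin 3) ℝ :=
  M.submatrix id (fun a => (j, a))

end NView

end

/-! A projective change of coordinates makes all centers affine, so the cameras become `A i * [1 |
-t i]`. With `B i = (A i)⁻¹`, having a solution means that each `F i j` is, up to scale, `(B i)ᵀ *
skew (t j - t i) * B j` (`IsModel`), and suitable scalars turn the n-view matrix into `modelMatrix B
t`.

From cameras to ranks: set `C j = skew (t j) * B j`. Since `skew` is linear and antisymmetric, the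
model matrix is `CᵀB + BᵀC` for the stacked rows `B` and `C`. If the `t j` are not collinear, these
six rows are independent and the rank is 6. If `t j = a j • d + p`, the matrix factors instead
through the rows `B j` and `a j • B j` and a form built from `skew d`, and the rank is 4. Block rows
have ranks 3 and 2 respectively.

From ranks to cameras: in both cases the rank of `M` is twice that of a block row `C`. The zero
diagonal block makes a coordinate subspace isotropic; a dimension count then shows that `M` vanishes
as a form on `ker C`, so `M = CᵀB + BᵀC` for some `B` (`exists_eq_symmetrization`). The remaining
freedom is used twice. Changing `B j` modulo the kernel of `Cᵀ` removes common kernels of `B j` and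
`C j` (`exists_lift`). Replacing `B j` by `B j - skew s * C j` leaves `M` unchanged and, for generic
`s`, makes every block invertible (`exists_det_sub_skew_mul_ne_zero`). The zero diagonal blocks then
say that `C j * (B j)⁻¹` is antisymmetric, hence equal to `skew (t j)`, and `t j` is the center.
Whether the recovered centers are collinear is read off from the rank, 4 or 6. -/

namespace NView

/-! ### Ranks, kernels and symmetric forms with a large isotropic subspace -/

section Rank

variable {m n k : Type*} [Fintype n] [Fintype k]

theorem rank_add_finrank_ker (A : Matrix m n ℝ) :
    A.rank + Module.finrank ℝ (LinearMap.ker A.mulVecLin) = Fintype.card n := by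
  have h := LinearMap.finrank_range_add_finrank_ker A.mulVecLin
  rwa [Module.finrank_fintype_fun_eq_card] at h

theorem ker_mulVecLin_eq_bot {A : Matrix m n ℝ} (h : ∀ v, A *ᵥ v = 0 → v = 0) :
    LinearMap.ker A.mulVecLin = ⊥ :=
  LinearMap.ker_eq_bot'.2 fun v hv => h v hv

theorem rank_eq_card_of_ker {A : Matrix m n ℝ} (h : ∀ v, A *ᵥ v = 0 → v = 0) :
    A.rank = Fintype.card n := by
  have := rank_add_finrank_ker A
  rwa [ker_mulVecLin_eq_bot h, finrank_bot, add_zero] at this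

theorem ker_of_rank_eq_card {A : Matrix m n ℝ} (h : A.rank = Fintype.card n) {v : n → ℝ}
    (hv : A *ᵥ v = 0) : v = 0 := by
  have h1 := rank_add_finrank_ker A
  rw [h, Nat.add_eq_left, Submodule.finrank_eq_zero] at h1
  exact LinearMap.ker_eq_bot'.1 h1 v hv

/-- A parametrization of the kernel by `E` determines the rank. -/
theorem rank_add_card_of_ker {A : Matrix m n ℝ} (E : Matrix n k ℝ)
    (hE : ∀ v, E *ᵥ v = 0 → v = 0) (hA : ∀ v, A *ᵥ v = 0 ↔ ∃ c, v = E *ᵥ c) :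
    A.rank + Fintype.card k = Fintype.card n := by
  have h : LinearMap.ker A.mulVecLin = LinearMap.range E.mulVecLin := by
    ext v
    simp [hA, eq_comm]
  rw [← rank_add_finrank_ker A, h, ← rank_eq_card_of_ker hE]
  rfl

theorem rank_mul_of_ker {A : Matrix m n ℝ} (hA : ∀ v, A *ᵥ v = 0 → v = 0) (X : Matrix n k ℝ) :
    (A * X).rank = X.rank := by
  have h1 := rank_add_finrank_ker (A * X)
  have h2 := rank_add_finrank_ker X
  have h : LinearMap.ker (A * X).mulVecLin = LinearMap.ker X.mulVecLin := by
    ext v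
    simp only [LinearMap.mem_ker, Matrix.mulVecLin_apply, ← Matrix.mulVec_mulVec]
    exact ⟨hA _, fun h => by rw [h, Matrix.mulVec_zero]⟩
  rw [h] at h1
  omega

theorem rank_mul_of_ker_transpose [Fintype m] {Y : Matrix n k ℝ} (hY : ∀ v, Yᵀ *ᵥ v = 0 → v = 0)
    (X : Matrix m n ℝ) : (X * Y).rank = X.rank := by
  rw [← Matrix.rank_transpose, Matrix.transpose_mul, rank_mul_of_ker hY, Matrix.rank_transpose]

theorem rank_transpose_mul_mul {Y : Matrix n k ℝ} (hY : ∀ v, Yᵀ *ᵥ v = 0 → v = 0)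
    (X : Matrix n n ℝ) : (Yᵀ * X * Y).rank = X.rank := by
  rw [rank_mul_of_ker_transpose hY, rank_mul_of_ker hY]

theorem exists_ker_of_rank_two {A : Matrix (Fin 3) (Fin 3) ℝ} (h : A.rank = 2) :
    ∃ k, k ≠ 0 ∧ A *ᵥ k = 0 ∧ ∀ v, A *ᵥ v = 0 → ∃ c : ℝ, v = c • k := by
  have h1 := rank_add_finrank_ker A
  rw [h, Fintype.card_fin] at h1
  obtain ⟨⟨k, hk⟩, hk0, hk1⟩ := finrank_eq_one_iff'.1
    (show Module.finrank ℝ (LinearMap.ker A.mulVecLin) = 1 by omega)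
  refine ⟨k, fun h => hk0 (Subtype.ext h), hk, fun v hv => ?_⟩
  obtain ⟨c, hc⟩ := hk1 ⟨v, hv⟩
  exact ⟨c, (congrArg Subtype.val hc).symm⟩

/-- Compose a projection onto the range of `C` with a section of `C` over its range. -/
theorem exists_generalized_inverse [Fintype m] (C : Matrix m n ℝ) : ∃ E : Matrix n m ℝ, C * E * C = C := by
  classical
  obtain ⟨f, hf⟩ := C.mulVecLin.rangeRestrict.exists_rightInverse_of_surjective
    (LinearMap.range_eq_top.2 C.mulVecLin.surjective_rangeRestrict)
  obtain ⟨g, hg⟩ := (LinearMap.range C.mulVecLin).subtype.exists_leftInverse_of_injective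
    (Submodule.ker_subtype _)
  refine ⟨LinearMap.toMatrix' (f ∘ₗ g), ?_⟩
  apply Matrix.toLin'.injective
  refine LinearMap.pi_ext' fun i => LinearMap.ext_ring ?_
  simp only [Matrix.toLin'_mul, Matrix.toLin'_toMatrix', LinearMap.comp_apply]
  set v := LinearMap.single ℝ (fun _ => ℝ) i 1
  have h1 : g (Matrix.toLin' C v) = C.mulVecLin.rangeRestrict v :=
    LinearMap.congr_fun hg (C.mulVecLin.rangeRestrict v)
  have h2 := congrArg Subtype.val (LinearMap.congr_fun hf (C.mulVecLin.rangeRestrict v))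
  rw [h1]
  exact h2

/-- Write `r` for the rank of `C = Iᵀ * M` and `N` for the size of `M`. As `ker M ≤ ker C`, the
image `M (ker C)` has dimension `(N - r) - (N - 2r) = r`, exactly that of the range of `Cᵀ`. -/
theorem exists_mulVec_transpose_of_rank [Fintype m] {M : Matrix n n ℝ} (hM : Mᵀ = M)
    (I : Matrix n m ℝ) (hI : Iᵀ * M * I = 0) (hr : M.rank = 2 * (Iᵀ * M).rank) {v : n → ℝ}
    (hv : (Iᵀ * M) *ᵥ v = 0) : ∃ b, M *ᵥ v = (Iᵀ * M)ᵀ *ᵥ b := by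
  set C := Iᵀ * M with hC
  have hCt : Cᵀ = M * I := by rw [hC, Matrix.transpose_mul, hM, Matrix.transpose_transpose]
  set K := LinearMap.ker C.mulVecLin with hK
  have h1 := LinearMap.finrank_range_add_finrank_ker (M.mulVecLin.domRestrict K)
  have h2 := rank_add_finrank_ker M
  have h3 := rank_add_finrank_ker C
  rw [← hK] at h3
  have hle : LinearMap.ker M.mulVecLin ≤ K := by
    intro v hv
    have : M *ᵥ v = 0 := hv
    simp [hK, hC, this]
  have h4 : Module.finrank ℝ (LinearMap.ker (M.mulVecLin.domRestrict K)) =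
      Module.finrank ℝ (LinearMap.ker M.mulVecLin) := by
    rw [LinearMap.ker_domRestrict]
    exact (Submodule.comapSubtypeEquivOfLe hle).finrank_eq
  -- Isotropy puts the range of `I` inside `ker C`, and `Cᵀ = M * I`; this gives one inclusion, and
  -- equal dimensions give the other.
  have h5 : LinearMap.range Cᵀ.mulVecLin = LinearMap.range (M.mulVecLin.domRestrict K) := by
    apply Submodule.eq_of_le_of_finrank_eq
    · rintro _ ⟨b, rfl⟩
      refine ⟨⟨I *ᵥ b, ?_⟩, ?_⟩
      · simp [hK, Matrix.mulVec_mulVec, hI]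
      · simp [hCt, Matrix.mulVec_mulVec]
    · have h6 : Module.finrank ℝ (LinearMap.range Cᵀ.mulVecLin) = C.rank := Matrix.rank_transpose C
      rw [h6]
      omega
  have h7 : M *ᵥ v ∈ LinearMap.range Cᵀ.mulVecLin := h5 ▸ ⟨⟨v, hv⟩, rfl⟩
  obtain ⟨b, hb⟩ := h7
  exact ⟨b, hb.symm⟩

/-- A symmetric matrix which vanishes on the image of `I`, with rank twice the rank of
`C = Iᵀ * M`, is the symmetrization of `Cᵀ * B` for some `B`. -/
theorem exists_eq_symmetrization [Fintype m] [DecidableEq n] {M : Matrix n n ℝ}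
    (hM : Mᵀ = M) (I : Matrix n m ℝ) (hI : Iᵀ * M * I = 0) (hr : M.rank = 2 * (Iᵀ * M).rank) :
    ∃ B : Matrix m n ℝ, M = (Iᵀ * M)ᵀ * B + Bᵀ * (Iᵀ * M) := by
  obtain ⟨E, hE⟩ := exists_generalized_inverse (Iᵀ * M)
  have key := fun v hv => exists_mulVec_transpose_of_rank hM I hI hr (v := v) hv
  set C := Iᵀ * M
  have hCp : C * (1 - E * C) = 0 := by rw [Matrix.mul_sub, ← Matrix.mul_assoc, hE]; simp
  -- `1 - E * C` maps into `ker C`, where `M v = Cᵀ b`; pairing with another vector of `ker C` gives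
  -- zero.
  have hz : (1 - E * C)ᵀ * M * (1 - E * C) = 0 := by
    apply Matrix.ext_of_mulVec_single
    intro i
    obtain ⟨b, hb⟩ := key ((1 - E * C) *ᵥ Pi.single i 1) (by rw [Matrix.mulVec_mulVec, hCp, Matrix.zero_mulVec])
    rw [← Matrix.mulVec_mulVec, ← Matrix.mulVec_mulVec, hb, Matrix.mulVec_mulVec,
      ← Matrix.transpose_mul, hCp]
    simp
    rfl
  -- Expand `M` along `1 = (1 - E * C) + E * C`. The mixed terms go one to each summand; the term
  -- with `E * C` on both sides is split in half.
  refine ⟨Eᵀ * M * (1 - E * C) + (1 / 2 : ℝ) • (Eᵀ * M * (E * C)), ?_⟩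
  have hz' : M = (E * C)ᵀ * M * (1 - E * C) + (1 - E * C)ᵀ * M * (E * C)
      + (E * C)ᵀ * M * (E * C) := by
    have : M = (1 - E * C)ᵀ * M * (1 - E * C) + ((E * C)ᵀ * M * (1 - E * C) +
        (1 - E * C)ᵀ * M * (E * C) + (E * C)ᵀ * M * (E * C)) := by
      simp only [Matrix.transpose_sub, Matrix.transpose_one]
      noncomm_ring
    rwa [hz, zero_add] at this
  have hh : ∀ X : Matrix n n ℝ, X = (1 / 2 : ℝ) • X + (1 / 2 : ℝ) • X := fun X => by
    rw [← add_smul]; norm_num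
  have e1 : Cᵀ * (Eᵀ * M * (1 - E * C) + (1 / 2 : ℝ) • (Eᵀ * M * (E * C))) =
      (E * C)ᵀ * M * (1 - E * C) + (1 / 2 : ℝ) • ((E * C)ᵀ * M * (E * C)) := by
    simp only [Matrix.transpose_mul, Matrix.mul_add, Matrix.mul_smul, Matrix.mul_assoc]
  have e2 : (Eᵀ * M * (1 - E * C) + (1 / 2 : ℝ) • (Eᵀ * M * (E * C)))ᵀ * C =
      (1 - E * C)ᵀ * M * (E * C) + (1 / 2 : ℝ) • ((E * C)ᵀ * M * (E * C)) := by
    simp only [Matrix.transpose_mul, Matrix.transpose_add, Matrix.transpose_smul, hM,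
      Matrix.transpose_transpose, Matrix.add_mul, Matrix.smul_mul, Matrix.mul_assoc]
  rw [e1, e2]
  nth_rw 1 [hz', hh ((E * C)ᵀ * M * (E * C))]
  abel

end Rank

/-! ### Cross product matrices and invertibility of a shifted block -/

section Skew

/-- The matrix of the cross product with `t`. -/
def skew {R : Type*} [CommRing R] (t : Fin 3 → R) : Matrix (Fin 3) (Fin 3) R :=
  !![0, -t 2, t 1; t 2, 0, -t 0; -t 1, t 0, 0]

theorem skew_transpose (t : Fin 3 → ℝ) : (skew t)ᵀ = -skew t := by
  ext i j
  fin_cases i <;> fin_cases j <;> simp [skew]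

theorem skew_sub (s t : Fin 3 → ℝ) : skew (s - t) = skew s - skew t := by
  ext i j
  fin_cases i <;> fin_cases j <;> simp [skew] <;> ring

theorem skew_smul (c : ℝ) (t : Fin 3 → ℝ) : skew (c • t) = c • skew t := by
  ext i j
  fin_cases i <;> fin_cases j <;> simp [skew]

theorem skew_mulVec_self (t : Fin 3 → ℝ) : skew t *ᵥ t = 0 := by
  ext i
  fin_cases i <;> simp [skew, Matrix.mulVec, dotProduct, Fin.sum_univ_three] <;> ring

theorem skew_mulVec_anticomm (s t : Fin 3 → ℝ) : skew s *ᵥ t = -(skew t *ᵥ s) := by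
  ext i
  fin_cases i <;> simp [skew, Matrix.mulVec, dotProduct, Fin.sum_univ_three] <;> ring

theorem exists_eq_skew {A : Matrix (Fin 3) (Fin 3) ℝ} (h : Aᵀ + A = 0) : ∃ t, A = skew t := by
  have h' : ∀ i j, A j i + A i j = 0 := fun i j => congrFun (congrFun h i) j
  refine ⟨![A 2 1, A 0 2, A 1 0], ?_⟩
  ext i j
  fin_cases i <;> fin_cases j <;> simp [skew] <;>
    linarith [h' 0 0, h' 1 1, h' 2 2, h' 0 1, h' 0 2, h' 1 2]

theorem exists_smul_of_skew_mulVec {d v : Fin 3 → ℝ} (hd : d ≠ 0) (h : skew d *ᵥ v = 0) :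
    ∃ c : ℝ, v = c • d := by
  have h0 := congrFun h 0
  have h1 := congrFun h 1
  have h2 := congrFun h 2
  simp [skew, Matrix.mulVec, dotProduct, Fin.sum_univ_three] at h0 h1 h2
  obtain ⟨i, hi⟩ := Function.ne_iff.1 hd
  simp only [Pi.zero_apply] at hi
  refine ⟨v i / d i, ?_⟩
  ext j
  simp only [Pi.smul_apply, smul_eq_mul]
  rw [div_mul_eq_mul_div, eq_div_iff hi]
  fin_cases i <;> fin_cases j <;> simp <;> linarith

theorem mulVec_col_eq_smul {n : Type*} (d : n → ℝ) (c : Unit → ℝ) :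
    Matrix.replicateCol Unit d *ᵥ c = c () • d := by
  ext i
  simp [Matrix.mulVec, dotProduct, mul_comm]

theorem rank_skew {d : Fin 3 → ℝ} (hd : d ≠ 0) : (skew d).rank = 2 := by
  have h := rank_add_card_of_ker (A := skew d) (Matrix.replicateCol Unit d)
    (fun c hc => by
      rw [mulVec_col_eq_smul, smul_eq_zero, or_iff_left hd] at hc
      exact funext fun _ => hc)
    (fun v => ⟨fun h => by
      obtain ⟨c, hc⟩ := exists_smul_of_skew_mulVec hd h
      exact ⟨fun _ => c, by rw [mulVec_col_eq_smul, hc]⟩, by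
      rintro ⟨c, rfl⟩
      rw [mulVec_col_eq_smul, Matrix.mulVec_smul, skew_mulVec_self, smul_zero]⟩)
  simpa using h

/-- If `C` has rank two, `Cᵀ * B` is skew-symmetric and `B`, `C` have no common kernel, then
`B - skew s * C` is invertible for some `s`. -/
theorem exists_det_sub_skew_mul_ne_zero {B C : Matrix (Fin 3) (Fin 3) ℝ} (hC : C.rank = 2)
    (hBC : Cᵀ * B + Bᵀ * C = 0) (hinj : ∀ v, B *ᵥ v = 0 → C *ᵥ v = 0 → v = 0) :
    ∃ s, (B - skew s * C).det ≠ 0 := by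
  obtain ⟨k, hk0, hk, hker⟩ := exists_ker_of_rank_two hC
  set w := B *ᵥ k with hw
  have hw0 : w ≠ 0 := fun h => hk0 (hinj k h hk)
  have hCw : Cᵀ *ᵥ w = 0 := by
    have := congrArg (· *ᵥ k) hBC
    simpa [Matrix.add_mulVec, ← Matrix.mulVec_mulVec, hk] using this
  obtain ⟨m, hm⟩ := exists_eq_skew (A := Cᵀ * B) (by
    rw [Matrix.transpose_mul, Matrix.transpose_transpose, add_comm]; exact hBC)
  obtain ⟨m', hm'⟩ := exists_eq_skew (A := Cᵀ * skew w * C) (by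
    simp [Matrix.transpose_mul, skew_transpose, Matrix.mul_assoc])
  -- `skew m` and `skew m'` both kill `k`, so `m` and `m'` are multiples of `k`.
  obtain ⟨μ, rfl⟩ := exists_smul_of_skew_mulVec hk0 (v := m) (by
    rw [skew_mulVec_anticomm, ← hm, ← Matrix.mulVec_mulVec, ← hw, hCw, neg_zero])
  obtain ⟨μ', rfl⟩ := exists_smul_of_skew_mulVec hk0 (v := m') (by
    rw [skew_mulVec_anticomm, ← hm', ← Matrix.mulVec_mulVec, hk, Matrix.mulVec_zero, neg_zero])
  -- If `μ' = 0`, then `w × Cv` lies in `ker Cᵀ`, the line of `w`, yet is orthogonal to `w`, so it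
  -- vanishes. Then `Cv` is parallel as well as orthogonal to `w`, which forces `C = 0`.
  have hμ' : μ' ≠ 0 := by
    rintro rfl
    obtain ⟨l, hl0, hl, hlker⟩ := exists_ker_of_rank_two (A := Cᵀ) (by rwa [Matrix.rank_transpose])
    have hlw : ∃ c : ℝ, l = c • w := by
      obtain ⟨c, hc⟩ := hlker w hCw
      have : c ≠ 0 := fun h => hw0 (by rw [hc, h, zero_smul])
      exact ⟨c⁻¹, by rw [hc, inv_smul_smul₀ this]⟩
    obtain ⟨c, rfl⟩ := hlw
    have hzero : ∀ v, C *ᵥ v = 0 := by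
      intro v
      have h1 : Cᵀ *ᵥ (skew w *ᵥ (C *ᵥ v)) = 0 := by
        rw [Matrix.mulVec_mulVec, Matrix.mulVec_mulVec, hm', zero_smul]
        simp [skew, dotProduct, Fin.sum_univ_three]
      have hwC : w ⬝ᵥ (C *ᵥ v) = 0 := by
        rw [Matrix.dotProduct_mulVec, ← Matrix.mulVec_transpose, hCw, zero_dotProduct]
      obtain ⟨a, ha⟩ := hlker _ h1
      have h2 : w ⬝ᵥ (skew w *ᵥ (C *ᵥ v)) = 0 := by
        rw [Matrix.dotProduct_mulVec, ← Matrix.mulVec_transpose, skew_transpose, Matrix.neg_mulVec,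
          skew_mulVec_self, neg_zero, zero_dotProduct]
      have hww : w ⬝ᵥ w ≠ 0 := fun h => hw0 (dotProduct_self_eq_zero.1 h)
      have h3 : skew w *ᵥ (C *ᵥ v) = 0 := by
        rw [ha, smul_smul, dotProduct_smul, smul_eq_mul, mul_eq_zero, or_iff_left hww] at h2
        rw [ha, smul_smul, h2, zero_smul]
      obtain ⟨b, hb⟩ := exists_smul_of_skew_mulVec hw0 h3
      rw [hb, dotProduct_smul, smul_eq_mul, mul_eq_zero, or_iff_left hww] at hwC
      rw [hb, hwC, zero_smul]
    have : C = 0 := Matrix.ext_of_mulVec_single fun i => by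
      rw [hzero, Matrix.zero_mulVec]
    rw [this, Matrix.rank_zero] at hC
    omega
  -- The coefficient makes `Cᵀ * (B - skew s * C) = skew k`. A kernel vector is therefore a multiple
  -- of `k`, and `k` itself is sent to `w ≠ 0`.
  refine ⟨((μ - 1) / μ') • w, fun hdet => ?_⟩
  obtain ⟨v, hv0, hv⟩ := Matrix.exists_mulVec_eq_zero_iff.2 hdet
  have h1 : Cᵀ * (B - skew (((μ - 1) / μ') • w) * C) = skew k := by
    rw [skew_smul, Matrix.mul_sub, hm, Matrix.smul_mul, Matrix.mul_smul, ← Matrix.mul_assoc, hm',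
      skew_smul, skew_smul, smul_smul, div_mul_cancel₀ _ hμ', ← sub_smul]
    simp
  obtain ⟨c, rfl⟩ := exists_smul_of_skew_mulVec hk0 (v := v) (by
    rw [← h1, ← Matrix.mulVec_mulVec, hv, Matrix.mulVec_zero])
  rw [Matrix.mulVec_smul, Matrix.sub_mulVec, ← Matrix.mulVec_mulVec, hk, Matrix.mulVec_zero,
    sub_zero, ← hw, smul_eq_zero, or_iff_left hw0] at hv
  exact hv0 (by rw [hv, zero_smul])

end Skew

/-- The product of finitely many non-zero polynomials is non-zero, and over the infinite field `ℝ`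
it does not vanish identically. This turns separate generic choices into a common one. -/
theorem exists_eval_ne_zero {ι σ : Type*} [Fintype ι] (p : ι → MvPolynomial σ ℝ)
    (h : ∀ i, ∃ x, MvPolynomial.eval x (p i) ≠ 0) : ∃ x, ∀ i, MvPolynomial.eval x (p i) ≠ 0 := by
  have hp : ∏ i, p i ≠ 0 := Finset.prod_ne_zero_iff.2 fun i _ h0 => by
    obtain ⟨x, hx⟩ := h i
    exact hx (by rw [h0, map_zero])
  by_contra! hcon
  refine hp (MvPolynomial.funext fun x => ?_)
  obtain ⟨i, hi⟩ := hcon x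
  rw [map_prod, map_zero]
  exact Finset.prod_eq_zero (Finset.mem_univ i) hi

theorem exists_common_det_sub_skew_mul_ne_zero {ι : Type*} [Fintype ι]
    (B C : ι → Matrix (Fin 3) (Fin 3) ℝ) (h : ∀ i, ∃ s, (B i - skew s * C i).det ≠ 0) :
    ∃ s, ∀ i, (B i - skew s * C i).det ≠ 0 := by
  have key : ∀ i s, MvPolynomial.eval s ((B i).map MvPolynomial.C -
      skew MvPolynomial.X * (C i).map MvPolynomial.C).det = (B i - skew s * C i).det := by
    intro i s
    rw [RingHom.map_det]
    congr 1
    ext a b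
    fin_cases a <;> simp [skew, Matrix.vecMul, dotProduct, Fin.sum_univ_three]
  simp only [← key] at h ⊢
  exact exists_eval_ne_zero _ h

/-! ### Affine cameras and the transformation rules of `psi` -/

/-- The camera `[1 | -t]` with center `(t, 1)`. -/
def euclideanCamera (t : Fin 3 → ℝ) : Matrix (Fin 3) (Fin 4) ℝ :=
  !![1, 0, 0, -t 0; 0, 1, 0, -t 1; 0, 0, 1, -t 2]

/-- Homogeneous coordinates of the affine point `t`. -/
def homogenize (t : Fin 3 → ℝ) : Fin 4 → ℝ := ![t 0, t 1, t 2, 1]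

/-- The pair matrix gets multiplied on the right by the block diagonal matrix of `K` and `1`: a
change of world coordinates only rescales `psi`. -/
theorem psi_mul_right (P Q : Matrix (Fin 3) (Fin 4) ℝ) (K : Matrix (Fin 4) (Fin 4) ℝ) :
    psi (P * K) (Q * K) = K.det • psi P Q := by
  have key : ∀ x y, pairMatrix (P * K) (Q * K) x y = pairMatrix P Q x y *
      (Matrix.fromBlocks K 0 0 1).submatrix (finSumFinEquiv (m := 4) (n := 2)).symm
        (finSumFinEquiv (m := 4) (n := 2)).symm := by
    intro x y
    rw [pairMatrix, pairMatrix, Matrix.submatrix_mul_equiv, Matrix.fromBlocks_multiply]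
    simp
  ext a b
  simp [psi, key, Matrix.det_mul, mul_comm]

theorem pairMatrix_mul_left (A B : Matrix (Fin 3) (Fin 3) ℝ) (P Q : Matrix (Fin 3) (Fin 4) ℝ)
    (x y : Fin 3 → ℝ) :
    pairMatrix (A * P) (B * Q) (A *ᵥ x) (B *ᵥ y) =
      (Matrix.fromBlocks A 0 0 B).submatrix (finSumFinEquiv (m := 3) (n := 3)).symm
        (finSumFinEquiv (m := 3) (n := 3)).symm * pairMatrix P Q x y := by
  rw [pairMatrix, pairMatrix, Matrix.submatrix_mul_equiv, Matrix.fromBlocks_multiply]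
  simp only [Matrix.zero_mul, add_zero, zero_add]
  congr 2
  · ext a j
    fin_cases j <;> simp [Matrix.mul_apply, Matrix.mulVec, dotProduct]
  · ext a j
    fin_cases j <;> simp [Matrix.mul_apply, Matrix.mulVec, dotProduct]

/-- Changing coordinates in the two images multiplies the pair matrix on the left by the block
diagonal matrix of `A` and `B`. -/
theorem transpose_mul_psi_mul (A B : Matrix (Fin 3) (Fin 3) ℝ) (P Q : Matrix (Fin 3) (Fin 4) ℝ) :
    Aᵀ * psi (A * P) (B * Q) * B = (A.det * B.det) • psi P Q := by
  ext a b
  have h := dotProduct_psi_mulVec (A * P) (B * Q) (A *ᵥ Pi.single a 1) (B *ᵥ Pi.single b 1)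
  rw [pairMatrix_mul_left, Matrix.det_mul, Matrix.det_submatrix_equiv_self,
    Matrix.det_fromBlocks_zero₁₂, ← dotProduct_psi_mulVec, Matrix.mulVec_mulVec,
    ← Matrix.vecMul_transpose, ← Matrix.dotProduct_mulVec, Matrix.mulVec_mulVec,
    ← Matrix.mul_assoc] at h
  simpa using h

theorem psi_euclideanCamera (s t : Fin 3 → ℝ) :
    psi (euclideanCamera s) (euclideanCamera t) = skew (s - t) := by
  have key : ∀ x y, (pairMatrix (euclideanCamera s) (euclideanCamera t) x y).det =
      Matrix.det !![s 0 - t 0, -x 0, y 0; s 1 - t 1, -x 1, y 1; s 2 - t 2, -x 2, y 2] := by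
    intro x y
    have h : pairMatrix (euclideanCamera s) (euclideanCamera t) x y =
        (Matrix.fromBlocks 1 !![-s 0, x 0, 0; -s 1, x 1, 0; -s 2, x 2, 0] 1
          !![-t 0, 0, y 0; -t 1, 0, y 1; -t 2, 0, y 2]).submatrix
          (finSumFinEquiv (m := 3) (n := 3)).symm (finSumFinEquiv (m := 3) (n := 3)).symm := by
      ext i j
      fin_cases i <;> fin_cases j <;> rfl
    -- The upper left block is the identity, so the determinant is that of the Schur complement.
    rw [h, Matrix.det_submatrix_equiv_self, Matrix.det_fromBlocks_one₁₁, one_mul]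
    congr 1
    ext i j
    fin_cases i <;> fin_cases j <;> simp [sub_eq_add_neg, add_comm]
  ext a b
  rw [psi, Matrix.of_apply, key, Matrix.det_fin_three]
  fin_cases a <;> fin_cases b <;> simp [skew]

theorem rank_euclideanCamera (t : Fin 3 → ℝ) : (euclideanCamera t).rank = 3 := by
  rw [← Matrix.rank_transpose]
  refine rank_eq_card_of_ker fun v hv => ?_
  ext i
  fin_cases i
  · simpa [euclideanCamera, Matrix.mulVec, dotProduct, Fin.sum_univ_three] using congrFun hv 0
  · simpa [euclideanCamera, Matrix.mulVec, dotProduct, Fin.sum_univ_three] using congrFun hv 1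
  · simpa [euclideanCamera, Matrix.mulVec, dotProduct, Fin.sum_univ_three] using congrFun hv 2

theorem euclideanCamera_mulVec_eq_zero {t : Fin 3 → ℝ} {v : Fin 4 → ℝ} :
    euclideanCamera t *ᵥ v = 0 ↔ ∃ c : ℝ, v = c • homogenize t := by
  constructor
  · intro h
    have h0 := congrFun h 0
    have h1 := congrFun h 1
    have h2 := congrFun h 2
    simp [euclideanCamera, Matrix.mulVec, dotProduct, Fin.sum_univ_four] at h0 h1 h2
    refine ⟨v 3, ?_⟩
    ext i
    fin_cases i <;> simp [homogenize] <;> linarith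
  · rintro ⟨c, rfl⟩
    ext i
    fin_cases i <;> simp [euclideanCamera, homogenize, Matrix.mulVec, dotProduct,
      Fin.sum_univ_four] <;> ring

theorem isUnit_det_of_ne_zero {m : Type*} [Fintype m] [DecidableEq m] {A : Matrix m m ℝ}
    (h : A.det ≠ 0) : IsUnit A.det := isUnit_iff_ne_zero.2 h

/-! ### Cameras in normalized form: fundamental matrices and centers -/

section Normalized

variable {ι : Type*} {P : ι → Matrix (Fin 3) (Fin 4) ℝ} {K : Matrix (Fin 4) (Fin 4) ℝ}
  {A : ι → Matrix (Fin 3) (Fin 3) ℝ} {t : ι → Fin 3 → ℝ}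

theorem psi_eq_of_normalized (hK : K.det ≠ 0) (hA : ∀ i, (A i).det ≠ 0)
    (h : ∀ i, P i * K = A i * euclideanCamera (t i)) (i j : ι) :
    ∃ c : ℝ, c ≠ 0 ∧ psi (P i) (P j) =
      c • ((A i)⁻¹ᵀ * skew (t j - t i) * (A j)⁻¹) := by
  have h1 := transpose_mul_psi_mul (A i) (A j) (euclideanCamera (t i)) (euclideanCamera (t j))
  rw [← h, ← h, psi_mul_right, psi_euclideanCamera] at h1
  refine ⟨-(K.det⁻¹ * ((A i).det * (A j).det)), by simp [hK, hA], ?_⟩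
  have h2 : psi (P i) (P j) = K.det⁻¹ • ((A i)⁻¹ᵀ *
      ((A i)ᵀ * (K.det • psi (P i) (P j)) * A j) * (A j)⁻¹) := by
    have e1 : (A i)⁻¹ᵀ * (A i)ᵀ = 1 := by
      rw [← Matrix.transpose_mul, Matrix.mul_nonsing_inv _ (isUnit_det_of_ne_zero (hA i)),
        Matrix.transpose_one]
    have e2 : A j * (A j)⁻¹ = 1 := Matrix.mul_nonsing_inv _ (isUnit_det_of_ne_zero (hA j))
    rw [Matrix.mul_assoc, Matrix.mul_assoc _ (A j), e2, Matrix.mul_one, ← Matrix.mul_assoc, e1,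
      Matrix.one_mul, inv_smul_smul₀ hK]
  rw [h2, h1, ← neg_sub (t j), ← neg_one_smul ℝ (t j - t i), skew_smul]
  simp only [Matrix.mul_smul, Matrix.smul_mul, smul_smul]
  congr 1
  ring

theorem mem_center_of_normalized (hK : K.det ≠ 0) (hA : ∀ i, (A i).det ≠ 0)
    (h : ∀ i, P i * K = A i * euclideanCamera (t i)) (i : ι) (v : Fin 4 → ℝ) :
    v ∈ center (P i) ↔ ∃ c : ℝ, v = c • (K *ᵥ homogenize (t i)) := by
  have h1 : P i *ᵥ v = A i *ᵥ (euclideanCamera (t i) *ᵥ (K⁻¹ *ᵥ v)) := by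
    rw [Matrix.mulVec_mulVec, Matrix.mulVec_mulVec, ← h, Matrix.mul_assoc,
      Matrix.mul_nonsing_inv _ (isUnit_det_of_ne_zero hK), Matrix.mul_one]
  have h2 : v ∈ center (P i) ↔ euclideanCamera (t i) *ᵥ (K⁻¹ *ᵥ v) = 0 := by
    change P i *ᵥ v = 0 ↔ _
    rw [h1]
    exact ⟨Matrix.eq_zero_of_mulVec_eq_zero (hA i), fun h => by rw [h, Matrix.mulVec_zero]⟩
  rw [h2, euclideanCamera_mulVec_eq_zero]
  refine exists_congr fun c => ⟨fun hc => ?_, fun hc => ?_⟩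
  · rw [← Matrix.mulVec_smul, ← hc, Matrix.mulVec_mulVec,
      Matrix.mul_nonsing_inv _ (isUnit_det_of_ne_zero hK), Matrix.one_mulVec]
  · rw [hc, ← Matrix.mulVec_smul, Matrix.mulVec_mulVec,
      Matrix.nonsing_inv_mul _ (isUnit_det_of_ne_zero hK), Matrix.one_mulVec]

/-- Two distinct centers determine the projective line. The last homogeneous coordinate is 1, so a
linear combination of their representatives that gives a third one has coefficients summing to 1,
that is, it is an affine combination. -/
theorem onALine_iff_collinear (hK : K.det ≠ 0) (hA : ∀ i, (A i).det ≠ 0)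
    (h : ∀ i, P i * K = A i * euclideanCamera (t i)) {i j : ι} (hij : t i ≠ t j) :
    OnALine (fun i => center (P i)) ↔ Collinear ℝ (Set.range t) := by
  have hmem := mem_center_of_normalized hK hA h
  set p := K *ᵥ homogenize (t i) with hp
  set q := K *ᵥ homogenize (t j) with hq
  have hKinj : ∀ v, K *ᵥ v = 0 → v = 0 := fun v => Matrix.eq_zero_of_mulVec_eq_zero hK
  have hind : LinearIndependent ℝ ![p, q] := by
    rw [LinearIndependent.pair_iff]
    intro a b hab
    rw [hp, hq, ← Matrix.mulVec_smul, ← Matrix.mulVec_smul, ← Matrix.mulVec_add] at hab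
    have h0 := hKinj _ hab
    have h3 : a + b = 0 := by simpa [homogenize] using congrFun h0 3
    have hb : b = -a := by linarith
    have ha : a = 0 := by
      by_contra ha
      apply hij
      ext l
      have hl : a * t i l + b * t j l = 0 := by
        fin_cases l
        · simpa [homogenize] using congrFun h0 0
        · simpa [homogenize] using congrFun h0 1
        · simpa [homogenize] using congrFun h0 2
      rw [hb] at hl
      exact mul_left_cancel₀ ha (by linarith)
    exact ⟨ha, by rw [hb, ha, neg_zero]⟩
  have hfin : Module.finrank ℝ (Submodule.span ℝ {p, q}) = 2 := by
    have := finrank_span_eq_card hind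
    rwa [Matrix.range_cons_cons_empty, Fintype.card_fin] at this
  have hcomb : ∀ l, K *ᵥ homogenize (t l) ∈ Submodule.span ℝ {p, q} ↔
      t l ∈ affineSpan ℝ {t i, t j} := by
    intro l
    rw [Submodule.mem_span_pair, mem_affineSpan_pair_iff_exists_lineMap_eq]
    constructor
    · rintro ⟨a, b, hab⟩
      rw [hp, hq, ← Matrix.mulVec_smul, ← Matrix.mulVec_smul, ← Matrix.mulVec_add,
        ← sub_eq_zero, ← Matrix.mulVec_sub] at hab
      have h0 := sub_eq_zero.1 (hKinj _ hab)
      have h3 : a + b = 1 := by simpa [homogenize] using congrFun h0 3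
      have ha : a = 1 - b := by linarith
      refine ⟨b, ?_⟩
      ext m
      have hm : a * t i m + b * t j m = t l m := by
        fin_cases m
        · simpa [homogenize] using congrFun h0 0
        · simpa [homogenize] using congrFun h0 1
        · simpa [homogenize] using congrFun h0 2
      rw [← hm, ha, AffineMap.lineMap_apply_module]
      simp
    · rintro ⟨b, hb⟩
      refine ⟨1 - b, b, ?_⟩
      rw [hp, hq, ← Matrix.mulVec_smul, ← Matrix.mulVec_smul, ← Matrix.mulVec_add, ← hb,
        AffineMap.lineMap_apply_module]
      congr 1
      ext m
      fin_cases m <;> simp [homogenize]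
  constructor
  · rintro ⟨L, hL, hc⟩
    have hKL : ∀ l, K *ᵥ homogenize (t l) ∈ L := fun l => hc l ((hmem l _).2 ⟨1, by simp⟩)
    have hLe : Submodule.span ℝ {p, q} = L := by
      apply Submodule.eq_of_le_of_finrank_eq
      · rw [Submodule.span_le]
        rintro x (rfl | rfl)
        exacts [hKL i, hKL j]
      · rw [hfin, hL]
    have hall : ∀ l, t l ∈ affineSpan ℝ {t i, t j} := fun l => (hcomb l).1 (hLe ▸ hKL l)
    rw [collinear_iff_of_mem (Set.mem_range_self i)]
    refine ⟨t j - t i, ?_⟩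
    rintro _ ⟨l, rfl⟩
    obtain ⟨r, hr⟩ := mem_affineSpan_pair_iff_exists_lineMap_eq.1 (hall l)
    exact ⟨r, by rw [← hr, AffineMap.lineMap_apply]; rfl⟩
  · intro hcol
    refine ⟨_, hfin, fun l v hv => ?_⟩
    obtain ⟨c, rfl⟩ := (hmem l v).1 hv
    exact Submodule.smul_mem _ _ ((hcomb l).2 (hcol.mem_affineSpan_of_mem_of_ne
      (Set.mem_range_self i) (Set.mem_range_self j) (Set.mem_range_self l) hij))

end Normalized

theorem eq_mul_euclideanCamera {Q : Matrix (Fin 3) (Fin 4) ℝ}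
    (h : (Q.submatrix id Fin.castSucc).det ≠ 0) :
    ∃ t, Q = Q.submatrix id Fin.castSucc * euclideanCamera t := by
  set A := Q.submatrix id Fin.castSucc with hA
  refine ⟨-(A⁻¹ *ᵥ fun a => Q a 3), ?_⟩
  have h1 : A *ᵥ (A⁻¹ *ᵥ fun a => Q a 3) = fun a => Q a 3 := by
    rw [Matrix.mulVec_mulVec, Matrix.mul_nonsing_inv _ (isUnit_det_of_ne_zero h),
      Matrix.one_mulVec]
  generalize (A⁻¹ *ᵥ fun a => Q a 3) = w at h1
  ext a j
  fin_cases j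
  · simp [Matrix.mul_apply, Fin.sum_univ_three, euclideanCamera, hA]
  · simp [Matrix.mul_apply, Fin.sum_univ_three, euclideanCamera, hA]
  · simp [Matrix.mul_apply, Fin.sum_univ_three, euclideanCamera, hA]
  · simpa [Matrix.mul_apply, Matrix.mulVec, dotProduct, Fin.sum_univ_three, euclideanCamera]
      using (congrFun h1 a).symm

theorem det_ne_zero_of_ker {m : Type*} [Fintype m] [DecidableEq m] {A : Matrix m m ℝ}
    (h : ∀ v, A *ᵥ v = 0 → v = 0) : A.det ≠ 0 := fun h0 => by
  obtain ⟨v, hv0, hv⟩ := Matrix.exists_mulVec_eq_zero_iff.2 h0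
  exact hv0 (h v hv)

/-- After a projective transformation, the centers of finitely many cameras are affine points. -/
theorem exists_normalized {n : ℕ} {P : Fin n → Matrix (Fin 3) (Fin 4) ℝ}
    (hP : ∀ i, IsCamera (P i)) :
    ∃ (K : Matrix (Fin 4) (Fin 4) ℝ) (A : Fin n → Matrix (Fin 3) (Fin 3) ℝ)
      (t : Fin n → Fin 3 → ℝ), K.det ≠ 0 ∧ (∀ i, (A i).det ≠ 0) ∧
      ∀ i, P i * K = A i * euclideanCamera (t i) := by
  let X : Matrix (Fin 4) (Fin 4) (MvPolynomial (Fin 4 × Fin 4) ℝ) :=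
    Matrix.mvPolynomialX (Fin 4) (Fin 4) ℝ
  let Q : Fin n → Matrix (Fin 3) (Fin 3) (MvPolynomial (Fin 4 × Fin 4) ℝ) := fun i =>
    Matrix.of fun a b => ∑ l, MvPolynomial.C (P i a l) * X l b.castSucc
  let p : Option (Fin n) → MvPolynomial (Fin 4 × Fin 4) ℝ := fun o => o.elim X.det
    fun i => (Q i).det
  have hnone : ∀ x, MvPolynomial.eval x (p none) = (Matrix.of fun a b => x (a, b)).det := by
    intro x
    simp only [p, Option.elim_none]
    rw [RingHom.map_det]
    congr 1
    ext a b
    simp [X]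
  have hsome : ∀ x i, MvPolynomial.eval x (p (some i)) =
      ((P i * Matrix.of fun a b => x (a, b)).submatrix id Fin.castSucc).det := by
    intro x i
    simp only [p, Option.elim_some]
    rw [RingHom.map_det]
    congr 1
    ext a b
    simp [Q, X, Matrix.mul_apply]
  obtain ⟨x, hx⟩ := exists_eval_ne_zero p (by
    rintro (_ | i)
    · refine ⟨fun ab => (1 : Matrix (Fin 4) (Fin 4) ℝ) ab.1 ab.2, ?_⟩
      rw [hnone]
      change (1 : Matrix (Fin 4) (Fin 4) ℝ).det ≠ 0
      simp
    -- For a single camera take `K` to be `(P i)ᵀ` with a zero column appended: the left block of `P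
    -- i * K` is `P i * (P i)ᵀ`, invertible by full rank.
    · refine ⟨fun ab => (Fin.snoc (α := fun _ => ℝ) (fun l => P i l ab.1) 0 : Fin 4 → ℝ) ab.2, ?_⟩
      rw [hsome]
      have : (P i * Matrix.of fun a b => (Fin.snoc (α := fun _ => ℝ) (fun l => P i l a) 0 :
          Fin 4 → ℝ) b).submatrix id Fin.castSucc = P i * (P i)ᵀ := by
        ext a b
        simp [Matrix.mul_apply]
      rw [this]
      exact det_ne_zero_of_ker fun v => ker_of_rank_eq_card
        (by rw [Matrix.rank_self_mul_transpose]; exact hP i))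
  set K : Matrix (Fin 4) (Fin 4) ℝ := Matrix.of fun a b => x (a, b)
  have hdet : ∀ i, ((P i * K).submatrix id Fin.castSucc).det ≠ 0 := fun i => hsome x i ▸ hx (some i)
  choose t ht using fun i => eq_mul_euclideanCamera (hdet i)
  exact ⟨K, _, t, hnone x ▸ hx none, hdet, ht⟩

/-- Up to non-zero scalars, the matrices `F i j` are the fundamental matrices of the cameras
`(B i)⁻¹ * [1 | -t i]`. -/
structure IsModel {n : ℕ} (F : Fin n → Fin n → Matrix (Fin 3) (Fin 3) ℝ)
    (B : Fin n → Matrix (Fin 3) (Fin 3) ℝ) (t : Fin n → Fin 3 → ℝ) : Prop where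
  det_ne_zero : ∀ i, (B i).det ≠ 0
  eq_smul : ∀ i j, i ≠ j → ∃ c : ℝ, c ≠ 0 ∧ F i j = c • ((B i)ᵀ * skew (t j - t i) * B j)

/-! ### Solutions and models are equivalent -/

section Model

variable {n : ℕ} {F : Fin n → Fin n → Matrix (Fin 3) (Fin 3) ℝ}

/-- Equal centers would make the fundamental matrix zero, against rank two. -/
theorem IsModel.injective (hF : IsFundamentalFamily F) {B : Fin n → Matrix (Fin 3) (Fin 3) ℝ}
    {t : Fin n → Fin 3 → ℝ} (h : IsModel F B t) : Function.Injective t := by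
  intro i j hij
  by_contra hne
  obtain ⟨c, -, hc⟩ := h.eq_smul i j hne
  have h0 : skew (t j - t i) = 0 := by rw [skew_sub, hij, sub_self]
  have := hF.rank_eq i j hne
  rw [hc, h0, Matrix.mul_zero, Matrix.zero_mul, smul_zero, Matrix.rank_zero] at this
  omega

theorem IsSolution.exists_isModel (hn : 3 ≤ n) (hF : IsFundamentalFamily F)
    {P : Fin n → Matrix (Fin 3) (Fin 4) ℝ} (h : IsSolution F P) :
    ∃ B t, IsModel F B t ∧
      (OnALine (fun i => center (P i)) ↔ Collinear ℝ (Set.range t)) := by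
  obtain ⟨K, A, t, hK, hA, hP⟩ := exists_normalized h.isCamera
  have hM : IsModel F (fun i => (A i)⁻¹) t :=
    ⟨fun i => by simp [Matrix.det_nonsing_inv, hA], fun i j hij => by
      obtain ⟨c, hc, hc'⟩ := h.psi_eq i j hij
      obtain ⟨b, hb, hb'⟩ := psi_eq_of_normalized hK hA hP i j
      exact ⟨c * b, mul_ne_zero hc hb, by rw [hc', hb', smul_smul]⟩⟩
  have hne : t ⟨0, by omega⟩ ≠ t ⟨1, by omega⟩ := fun h => by simpa using hM.injective hF h
  exact ⟨_, t, hM, onALine_iff_collinear hK hA hP hne⟩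

theorem IsModel.exists_isSolution (hn : 3 ≤ n) (hF : IsFundamentalFamily F)
    {B : Fin n → Matrix (Fin 3) (Fin 3) ℝ} {t : Fin n → Fin 3 → ℝ} (h : IsModel F B t) :
    ∃ P, IsSolution F P ∧
      (OnALine (fun i => center (P i)) ↔ Collinear ℝ (Set.range t)) := by
  have hA : ∀ i, ((B i)⁻¹).det ≠ 0 := fun i => by
    simp [Matrix.det_nonsing_inv, h.det_ne_zero]
  have hP : ∀ i, ((B i)⁻¹ * euclideanCamera (t i)) * (1 : Matrix (Fin 4) (Fin 4) ℝ) =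
      (B i)⁻¹ * euclideanCamera (t i) :=
    fun i => Matrix.mul_one _
  have hK : (1 : Matrix (Fin 4) (Fin 4) ℝ).det ≠ 0 := by simp
  have hne : t ⟨0, by omega⟩ ≠ t ⟨1, by omega⟩ := fun h' => by simpa using h.injective hF h'
  refine ⟨fun i => (B i)⁻¹ * euclideanCamera (t i), ⟨fun i => ?_, fun i j hij => ?_⟩,
    onALine_iff_collinear hK hA hP hne⟩
  · rw [IsCamera, Matrix.rank_mul_eq_right_of_isUnit_det _ _ (isUnit_det_of_ne_zero (hA i)),
      rank_euclideanCamera]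
  · obtain ⟨c, hc, hc'⟩ := h.eq_smul i j hij
    obtain ⟨b, hb, hb'⟩ := psi_eq_of_normalized hK hA hP i j
    refine ⟨c * b⁻¹, mul_ne_zero hc (inv_ne_zero hb), ?_⟩
    rw [hb', smul_smul, mul_assoc, inv_mul_cancel₀ hb, mul_one, hc',
      Matrix.nonsing_inv_nonsing_inv _ (isUnit_det_of_ne_zero (h.det_ne_zero i)),
      Matrix.nonsing_inv_nonsing_inv _ (isUnit_det_of_ne_zero (h.det_ne_zero j))]

end Model

/-! ### Ranks of the model matrix -/

section Stack

variable {n : ℕ}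

/-- The block row with blocks `B j`. -/
def blocks (B : Fin n → Matrix (Fin 3) (Fin 3) ℝ) : Matrix (Fin 3) (Fin n × Fin 3) ℝ :=
  Matrix.of fun a p => B p.1 a p.2

theorem mul_blocks (A : Matrix (Fin 3) (Fin 3) ℝ) (B : Fin n → Matrix (Fin 3) (Fin 3) ℝ) :
    A * blocks B = blocks fun j => A * B j := by
  ext a p
  simp [blocks, Matrix.mul_apply]

theorem blocks_transpose_mul_apply (X Y : Fin n → Matrix (Fin 3) (Fin 3) ℝ)
    (p q : Fin n × Fin 3) :
    ((blocks X)ᵀ * blocks Y) p q = ((X p.1)ᵀ * Y q.1) p.2 q.2 := by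
  simp [blocks, Matrix.mul_apply]

theorem transpose_blocks_mulVec (B : Fin n → Matrix (Fin 3) (Fin 3) ℝ) (v : Fin 3 → ℝ)
    (p : Fin n × Fin 3) : ((blocks B)ᵀ *ᵥ v) p = ((B p.1)ᵀ *ᵥ v) p.2 := by
  simp [blocks, Matrix.mulVec, dotProduct]

theorem transpose_blocks_mulVec_eq_zero {B : Fin n → Matrix (Fin 3) (Fin 3) ℝ} {v : Fin 3 → ℝ}
    (h : (blocks B)ᵀ *ᵥ v = 0) (j : Fin n) : (B j)ᵀ *ᵥ v = 0 := by
  ext b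
  rw [← transpose_blocks_mulVec B v (j, b), h]
  rfl

theorem transpose_mulVec_eq_zero {A : Matrix (Fin 3) (Fin 3) ℝ} (hA : A.det ≠ 0) {v : Fin 3 → ℝ}
    (h : Aᵀ *ᵥ v = 0) : v = 0 :=
  Matrix.eq_zero_of_mulVec_eq_zero (by rwa [Matrix.det_transpose]) h

/-- The `3n × 3n` matrix with blocks `(B i)ᵀ * skew (t j - t i) * B j`. -/
def modelMatrix (B : Fin n → Matrix (Fin 3) (Fin 3) ℝ) (t : Fin n → Fin 3 → ℝ) :
    Matrix (Fin n × Fin 3) (Fin n × Fin 3) ℝ :=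
  Matrix.of fun p q => ((B p.1)ᵀ * skew (t q.1 - t p.1) * B q.1) p.2 q.2

theorem modelMatrix_transpose (B : Fin n → Matrix (Fin 3) (Fin 3) ℝ) (t : Fin n → Fin 3 → ℝ) :
    (modelMatrix B t)ᵀ = modelMatrix B t := by
  ext p q
  simp only [modelMatrix, Matrix.transpose_apply, Matrix.of_apply]
  rw [← Matrix.transpose_apply ((B q.1)ᵀ * skew (t p.1 - t q.1) * B p.1), Matrix.transpose_mul,
    Matrix.transpose_mul, skew_transpose, Matrix.transpose_transpose, ← Matrix.mul_assoc,
    skew_sub, skew_sub, neg_sub]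

theorem rank_blockCol {M : Matrix (Fin n × Fin 3) (Fin n × Fin 3) ℝ} (hM : Mᵀ = M) (j : Fin n) :
    (blockCol M j).rank = (blockRow M j).rank := by
  rw [← Matrix.rank_transpose]
  have : (blockCol M j)ᵀ = blockRow Mᵀ j := rfl
  rw [this, hM]

theorem blockRow_modelMatrix (B : Fin n → Matrix (Fin 3) (Fin 3) ℝ) (t : Fin n → Fin 3 → ℝ)
    (i : Fin n) :
    blockRow (modelMatrix B t) i = (B i)ᵀ * blocks fun j => skew (t j - t i) * B j := by
  rw [mul_blocks]
  ext a p
  simp [blockRow, modelMatrix, blocks, Matrix.mul_assoc]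

variable {B : Fin n → Matrix (Fin 3) (Fin 3) ℝ} {t : Fin n → Fin 3 → ℝ}

theorem rank_blockRow_modelMatrix (hB : ∀ i, (B i).det ≠ 0) (i : Fin n) :
    (blockRow (modelMatrix B t) i).rank = (blocks fun j => skew (t j - t i) * B j).rank := by
  rw [blockRow_modelMatrix, rank_mul_of_ker fun v hv => transpose_mulVec_eq_zero (hB i) hv]

section Collinear

variable {p d : Fin 3 → ℝ} {a : Fin n → ℝ}

theorem skew_sub_of_collinear (ht : ∀ i, t i = a i • d + p) (i j : Fin n) :
    skew (t j - t i) = (a j - a i) • skew d := by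
  rw [ht, ht, add_sub_add_right_eq_sub, ← sub_smul, skew_smul]

theorem rank_symplectic_skew {d : Fin 3 → ℝ} (hd : d ≠ 0) :
    (Matrix.fromBlocks 0 (skew d) (-skew d) 0).rank = 4 := by
  have h := rank_add_card_of_ker (A := Matrix.fromBlocks 0 (skew d) (-skew d) 0)
    (Matrix.fromBlocks (Matrix.replicateCol Unit d) 0 0 (Matrix.replicateCol Unit d))
    (fun c hc => by
      obtain ⟨c₁, c₂, rfl⟩ : ∃ c₁ c₂, c = Sum.elim c₁ c₂ := ⟨_, _, (Sum.elim_comp_inl_inr c).symm⟩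
      rw [Matrix.fromBlocks_mulVec, Sum.elim_comp_inl, Sum.elim_comp_inr, Matrix.zero_mulVec,
        Matrix.zero_mulVec, add_zero, zero_add, mulVec_col_eq_smul, mulVec_col_eq_smul] at hc
      have h1 : c₁ () • d = 0 := funext fun i => congrFun hc (Sum.inl i)
      have h2 : c₂ () • d = 0 := funext fun i => congrFun hc (Sum.inr i)
      rw [smul_eq_zero, or_iff_left hd] at h1 h2
      ext (_ | _)
      exacts [h1, h2])
    (fun v => by
      obtain ⟨v₁, v₂, rfl⟩ : ∃ v₁ v₂, v = Sum.elim v₁ v₂ := ⟨_, _, (Sum.elim_comp_inl_inr v).symm⟩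
      rw [Matrix.fromBlocks_mulVec, Sum.elim_comp_inl, Sum.elim_comp_inr, Matrix.zero_mulVec,
        Matrix.zero_mulVec, add_zero, zero_add]
      constructor
      · intro h
        have h1 : skew d *ᵥ v₂ = 0 := funext fun i => congrFun h (Sum.inl i)
        have h2 : -skew d *ᵥ v₁ = 0 := funext fun i => congrFun h (Sum.inr i)
        rw [Matrix.neg_mulVec, neg_eq_zero] at h2
        obtain ⟨c₁, rfl⟩ := exists_smul_of_skew_mulVec hd h2
        obtain ⟨c₂, rfl⟩ := exists_smul_of_skew_mulVec hd h1
        refine ⟨Sum.elim (fun _ => c₁) (fun _ => c₂), ?_⟩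
        rw [Matrix.fromBlocks_mulVec, Sum.elim_comp_inl, Sum.elim_comp_inr, Matrix.zero_mulVec,
          Matrix.zero_mulVec, add_zero, zero_add, mulVec_col_eq_smul, mulVec_col_eq_smul]
      · rintro ⟨c, hc⟩
        rw [Matrix.fromBlocks_mulVec, Matrix.zero_mulVec, Matrix.zero_mulVec, add_zero, zero_add,
          mulVec_col_eq_smul, mulVec_col_eq_smul, Sum.elim_eq_iff] at hc
        rw [hc.1, hc.2, Matrix.neg_mulVec, Matrix.mulVec_smul, Matrix.mulVec_smul,
          skew_mulVec_self, smul_zero, smul_zero, neg_zero]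
        exact Sum.elim_zero_zero)
  simp only [Fintype.card_sum, Fintype.card_unit, Fintype.card_fin] at h
  omega

theorem rank_modelMatrix_of_collinear (hB : ∀ i, (B i).det ≠ 0) (hd : d ≠ 0)
    (ht : ∀ i, t i = a i • d + p) {i₀ i₁ : Fin n} (ha : a i₀ ≠ a i₁) :
    (modelMatrix B t).rank = 4 := by
  -- The block is `(a j - a i) • (B i)ᵀ * skew d * B j`, a symplectic-type expression in the pairs
  -- `(B i, a i • B i)`; two distinct values of `a` make the stacked rows independent.
  have h : modelMatrix B t = (Matrix.fromRows (blocks B) (blocks fun j => a j • B j))ᵀ *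
      Matrix.fromBlocks 0 (skew d) (-skew d) 0 *
      Matrix.fromRows (blocks B) (blocks fun j => a j • B j) := by
    rw [Matrix.mul_assoc, Matrix.fromBlocks_mul_fromRows, Matrix.transpose_fromRows,
      Matrix.fromCols_mul_fromRows, Matrix.zero_mul, Matrix.zero_mul, add_zero, zero_add,
      mul_blocks, mul_blocks]
    ext x y
    rw [Matrix.add_apply, blocks_transpose_mul_apply, blocks_transpose_mul_apply,
      ← Matrix.add_apply, modelMatrix, Matrix.of_apply, skew_sub_of_collinear ht]
    refine congrFun (congrFun ?_ x.2) y.2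
    simp only [Matrix.mul_smul, Matrix.smul_mul, Matrix.transpose_smul, Matrix.neg_mul,
      Matrix.mul_neg, sub_smul, Matrix.sub_mul, Matrix.mul_sub, Matrix.mul_assoc]
    abel
  rw [h, rank_transpose_mul_mul, rank_symplectic_skew hd]
  intro v hv
  obtain ⟨v₁, v₂, rfl⟩ : ∃ v₁ v₂, v = Sum.elim v₁ v₂ := ⟨_, _, (Sum.elim_comp_inl_inr v).symm⟩
  rw [Matrix.transpose_fromRows, Matrix.fromCols_mulVec, Sum.elim_comp_inl,
    Sum.elim_comp_inr] at hv
  have h1 : ∀ j, v₁ + a j • v₂ = 0 := fun j => transpose_mulVec_eq_zero (hB j) (by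
    ext b
    have := congrFun hv (j, b)
    rw [Pi.add_apply, transpose_blocks_mulVec, transpose_blocks_mulVec] at this
    simpa [Matrix.mulVec_add, Matrix.mulVec_smul, Matrix.smul_mulVec] using this)
  have h2 : (a i₀ - a i₁) • v₂ = 0 := by
    rw [sub_smul, ← add_sub_add_left_eq_sub _ _ v₁, h1, h1, sub_zero]
  rw [smul_eq_zero, or_iff_right (sub_ne_zero.2 ha)] at h2
  have h3 := h1 i₀
  rw [h2, smul_zero, add_zero] at h3
  rw [h2, h3, Sum.elim_zero_zero]

theorem rank_blockRow_modelMatrix_of_collinear (hB : ∀ i, (B i).det ≠ 0) (hd : d ≠ 0)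
    (ht : ∀ i, t i = a i • d + p) {i j : Fin n} (ha : a i ≠ a j) :
    (blockRow (modelMatrix B t) i).rank = 2 := by
  have h : (blocks fun j => skew (t j - t i) * B j) =
      skew d * blocks fun j => (a j - a i) • B j := by
    rw [mul_blocks]
    simp only [skew_sub_of_collinear ht, Matrix.smul_mul, Matrix.mul_smul]
  rw [rank_blockRow_modelMatrix hB, h, rank_mul_of_ker_transpose, rank_skew hd]
  intro v hv
  have h1 := transpose_blocks_mulVec_eq_zero hv j
  rw [Matrix.transpose_smul, Matrix.smul_mulVec, smul_eq_zero,
    or_iff_right (sub_ne_zero.2 ha.symm)] at h1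
  exact transpose_mulVec_eq_zero (hB j) h1

end Collinear

section NonCollinear

/-- A non-zero `u` with all these cross products zero would be a common direction of all `t j - t
i`. -/
theorem eq_zero_of_not_collinear (ht : ¬ Collinear ℝ (Set.range t)) {i : Fin n} {u : Fin 3 → ℝ}
    (h : ∀ j, skew (t j - t i) *ᵥ u = 0) : u = 0 := by
  by_contra hu
  refine ht ((collinear_iff_of_mem (Set.mem_range_self i)).2 ⟨u, ?_⟩)
  rintro _ ⟨j, rfl⟩
  obtain ⟨c, hc⟩ := exists_smul_of_skew_mulVec hu (v := t j - t i) (by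
    rw [skew_mulVec_anticomm, h, neg_zero])
  exact ⟨c, by rw [← hc]; simp⟩

theorem rank_blockRow_modelMatrix_of_not_collinear (hB : ∀ i, (B i).det ≠ 0)
    (ht : ¬ Collinear ℝ (Set.range t)) (i : Fin n) :
    (blockRow (modelMatrix B t) i).rank = 3 := by
  rw [rank_blockRow_modelMatrix hB, ← Matrix.rank_transpose]
  refine rank_eq_card_of_ker fun u hu => eq_zero_of_not_collinear ht (i := i) fun j => ?_
  have h1 := transpose_blocks_mulVec_eq_zero hu j
  rw [Matrix.transpose_mul, ← Matrix.mulVec_mulVec, skew_transpose, Matrix.neg_mulVec] at h1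
  exact neg_eq_zero.1 (transpose_mulVec_eq_zero (hB j) h1)

theorem rank_modelMatrix_of_not_collinear (hB : ∀ i, (B i).det ≠ 0)
    (ht : ¬ Collinear ℝ (Set.range t)) (i : Fin n) : (modelMatrix B t).rank = 6 := by
  -- `M = BᵀC + CᵀB` with `C j = skew (t j) * B j`; the minus sign in `t j - t i` is absorbed by the
  -- antisymmetry of `skew (t i)`.
  have h : modelMatrix B t = (Matrix.fromRows (blocks B) (blocks fun j => skew (t j) * B j))ᵀ *
      (Matrix.fromBlocks 0 1 1 0 : Matrix (Fin 3 ⊕ Fin 3) (Fin 3 ⊕ Fin 3) ℝ) *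
      Matrix.fromRows (blocks B) (blocks fun j => skew (t j) * B j) := by
    rw [Matrix.mul_assoc, Matrix.fromBlocks_mul_fromRows, Matrix.transpose_fromRows,
      Matrix.fromCols_mul_fromRows, Matrix.zero_mul, Matrix.zero_mul, add_zero, zero_add,
      Matrix.one_mul, Matrix.one_mul]
    ext x y
    rw [Matrix.add_apply, blocks_transpose_mul_apply, blocks_transpose_mul_apply,
      ← Matrix.add_apply, modelMatrix, Matrix.of_apply, skew_sub]
    refine congrFun (congrFun ?_ x.2) y.2
    rw [Matrix.transpose_mul, skew_transpose]
    noncomm_ring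
  rw [h, rank_transpose_mul_mul]
  · refine rank_eq_card_of_ker fun v hv => ?_
    obtain ⟨v₁, v₂, rfl⟩ : ∃ v₁ v₂, v = Sum.elim v₁ v₂ := ⟨_, _, (Sum.elim_comp_inl_inr v).symm⟩
    rw [Matrix.fromBlocks_mulVec, Sum.elim_comp_inl, Sum.elim_comp_inr, Matrix.zero_mulVec,
      Matrix.zero_mulVec, add_zero, zero_add, Matrix.one_mulVec, Matrix.one_mulVec] at hv
    have h1 : v₂ = 0 := funext fun i => congrFun hv (Sum.inl i)
    have h2 : v₁ = 0 := funext fun i => congrFun hv (Sum.inr i)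
    rw [h1, h2, Sum.elim_zero_zero]
  · intro v hv
    obtain ⟨v₁, v₂, rfl⟩ : ∃ v₁ v₂, v = Sum.elim v₁ v₂ := ⟨_, _, (Sum.elim_comp_inl_inr v).symm⟩
    rw [Matrix.transpose_fromRows, Matrix.fromCols_mulVec, Sum.elim_comp_inl,
      Sum.elim_comp_inr] at hv
    have h1 : ∀ j, v₁ - skew (t j) *ᵥ v₂ = 0 := fun j => transpose_mulVec_eq_zero (hB j) (by
      ext b
      have := congrFun hv (j, b)
      rw [Pi.add_apply, transpose_blocks_mulVec, transpose_blocks_mulVec, ← Pi.add_apply,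
        Matrix.transpose_mul, skew_transpose, ← Matrix.mulVec_mulVec, ← Matrix.mulVec_add,
        Matrix.neg_mulVec, ← sub_eq_add_neg] at this
      exact this)
    have h2 : v₂ = 0 := eq_zero_of_not_collinear ht (i := i) fun j => by
      rw [skew_sub, Matrix.sub_mulVec, ← sub_sub_sub_cancel_left _ _ v₁, h1, h1, sub_zero]
    have h3 := h1 i
    rw [h2, Matrix.mulVec_zero, sub_zero] at h3
    rw [h2, h3, Sum.elim_zero_zero]

end NonCollinear

variable {F : Fin n → Fin n → Matrix (Fin 3) (Fin 3) ℝ}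

/-- The scalars are symmetric because `s i j` and `s j i` scale the same non-zero matrix `F j i` to
the same block. -/
theorem IsModel.exists_isScaling (hF : IsFundamentalFamily F) (h : IsModel F B t) :
    ∃ s, IsScaling s ∧ nViewMatrix s F = modelMatrix B t := by
  have h' : ∀ i j, ∃ c : ℝ, i ≠ j → c ≠ 0 ∧ c • F i j = (B i)ᵀ * skew (t j - t i) * B j := by
    intro i j
    by_cases hij : i = j
    · exact ⟨0, fun h => absurd hij h⟩
    · obtain ⟨c, hc, hc'⟩ := h.eq_smul i j hij
      exact ⟨c⁻¹, fun _ => ⟨inv_ne_zero hc, by rw [hc', inv_smul_smul₀ hc]⟩⟩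
  choose s hs using h'
  refine ⟨s, ⟨fun i j hij => (hs i j hij).1, fun i j hij => ?_⟩, ?_⟩
  · have h1 := congrArg Matrix.transpose (hs i j hij).2
    rw [Matrix.transpose_smul, hF.transpose_eq i j hij, Matrix.transpose_mul, Matrix.transpose_mul,
      Matrix.transpose_transpose, skew_transpose, skew_sub, neg_sub, ← skew_sub,
      ← Matrix.mul_assoc, ← (hs j i hij.symm).2, ← sub_eq_zero, ← sub_smul, smul_eq_zero] at h1
    refine sub_eq_zero.1 (h1.resolve_right fun h0 => ?_)
    have := hF.rank_eq j i hij.symm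
    rw [h0, Matrix.rank_zero] at this
    omega
  · ext x y
    by_cases hxy : x.1 = y.1
    · have h0 : skew (0 : Fin 3 → ℝ) = 0 := by
        rw [← zero_smul ℝ (0 : Fin 3 → ℝ), skew_smul, zero_smul]
      simp [nViewMatrix, modelMatrix, hxy, h0]
    · simp [nViewMatrix, modelMatrix, hxy, ← (hs _ _ hxy).2]

theorem IsModel.exists_rank_of_collinear (hn : 3 ≤ n) (hF : IsFundamentalFamily F)
    (h : IsModel F B t) (ht : Collinear ℝ (Set.range t)) :
    (modelMatrix B t).rank = 4 ∧ ∀ i, (blockRow (modelMatrix B t) i).rank = 2 := by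
  obtain ⟨p, d, hpd⟩ := (collinear_iff_exists_forall_eq_smul_vadd _).1 ht
  choose a ha using fun i => hpd (t i) (Set.mem_range_self i)
  have ha' : ∀ i, t i = a i • d + p := ha
  have hinj : ∀ i j, i ≠ j → a i ≠ a j := fun i j hij h' =>
    hij (h.injective hF (by rw [ha' i, ha' j, h']))
  have hd : d ≠ 0 := by
    rintro rfl
    have := h.injective hF (a₁ := ⟨0, by omega⟩) (a₂ := ⟨1, by omega⟩) (by simp [ha'])
    simp at this
  have : Nontrivial (Fin n) := Fin.nontrivial_iff_two_le.2 (by omega)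
  refine ⟨rank_modelMatrix_of_collinear h.det_ne_zero hd ha'
    (hinj ⟨0, by omega⟩ ⟨1, by omega⟩ (by simp)), fun i => ?_⟩
  obtain ⟨j, hj⟩ := exists_ne i
  exact rank_blockRow_modelMatrix_of_collinear h.det_ne_zero hd ha' (hinj i j hj.symm)

end Stack

/-! ### Reconstructing a model from the rank conditions -/

section Reconstruction

variable {n : ℕ}

/-- The `3 × 3` block of `M` at position `(i, j)`. -/
def block (M : Matrix (Fin n × Fin 3) (Fin n × Fin 3) ℝ) (i j : Fin n) :
    Matrix (Fin 3) (Fin 3) ℝ :=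
  M.submatrix (fun a => (i, a)) (fun b => (j, b))

theorem mul_blocks_congr {m : Type*} {A : Matrix m (Fin 3) ℝ}
    {X Y : Fin n → Matrix (Fin 3) (Fin 3) ℝ} (h : ∀ j, A * X j = A * Y j) :
    A * blocks X = A * blocks Y := by
  ext a p
  exact congrFun (congrFun (h p.1) a) p.2

theorem eq_block_of_eq_symmetrization {M : Matrix (Fin n × Fin 3) (Fin n × Fin 3) ℝ}
    {B C : Fin n → Matrix (Fin 3) (Fin 3) ℝ}
    (h : M = (blocks C)ᵀ * blocks B + (blocks B)ᵀ * blocks C) (i j : Fin n) :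
    block M i j = (C i)ᵀ * B j + (B i)ᵀ * C j := by
  ext a b
  rw [block, Matrix.submatrix_apply, h, Matrix.add_apply, blocks_transpose_mul_apply,
    blocks_transpose_mul_apply, Matrix.add_apply]

theorem blockCol_eq_of_eq_symmetrization {M : Matrix (Fin n × Fin 3) (Fin n × Fin 3) ℝ}
    {B C : Fin n → Matrix (Fin 3) (Fin 3) ℝ}
    (h : M = (blocks C)ᵀ * blocks B + (blocks B)ᵀ * blocks C) (j : Fin n) :
    blockCol M j = (blocks C)ᵀ * B j + (blocks B)ᵀ * C j := by
  ext p b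
  have := congrFun (congrFun (eq_block_of_eq_symmetrization h p.1 j) p.2) b
  simpa [block, blockCol, Matrix.mul_apply, blocks] using this

/-- A symmetric block matrix with zero diagonal blocks, with rank twice the rank of a block row. -/
theorem exists_blocks_symmetrization {M : Matrix (Fin n × Fin 3) (Fin n × Fin 3) ℝ} (hM : Mᵀ = M)
    (i₀ : Fin n) (hdiag : block M i₀ i₀ = 0) (hr : M.rank = 2 * (blockRow M i₀).rank) :
    ∃ B, M = (blocks (block M i₀))ᵀ * blocks B + (blocks B)ᵀ * blocks (block M i₀) := by
  -- `I` is the inclusion of the `i₀`-th coordinate block; the zero diagonal block says exactly that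
  -- its image is isotropic.
  let I : Matrix (Fin n × Fin 3) (Fin 3) ℝ := (1 : Matrix _ _ ℝ).submatrix id fun a => (i₀, a)
  have hI : Iᵀ * M = blockRow M i₀ := by
    ext a p
    simp [I, Matrix.mul_apply, Matrix.one_apply, blockRow]
  have hI' : Iᵀ * M * I = 0 := by
    rw [hI, ← hdiag]
    ext a b
    simp [I, Matrix.mul_apply, Matrix.one_apply, blockRow, block]
  obtain ⟨B, hB⟩ := exists_eq_symmetrization hM I hI' (by rw [hI, hr])
  rw [hI] at hB
  exact ⟨fun j => Matrix.of fun a b => B a (j, b), hB⟩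

/-- `B j` enters `M` only through `Cᵀ * B j`, so it may be altered by columns in the kernel of `Cᵀ`.
This freedom removes a common kernel with `C j`, which is needed for an invertible shift. -/
theorem exists_lift {M : Matrix (Fin n × Fin 3) (Fin n × Fin 3) ℝ} (hM : Mᵀ = M)
    {i₀ : Fin n} (hdiag : block M i₀ i₀ = 0) (hoff : ∀ j, i₀ ≠ j → (block M i₀ j).rank = 2)
    (hrow : ∀ j, (blockRow M j).rank = (blockRow M i₀).rank)
    {B : Fin n → Matrix (Fin 3) (Fin 3) ℝ}
    (hB : M = (blocks (block M i₀))ᵀ * blocks B + (blocks B)ᵀ * blocks (block M i₀)) (j : Fin n) :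
    ∃ B' : Matrix (Fin 3) (Fin 3) ℝ,
      (blocks (block M i₀))ᵀ * B' = (blocks (block M i₀))ᵀ * B j ∧
      ∀ v, B' *ᵥ v = 0 → block M i₀ j *ᵥ v = 0 → v = 0 := by
  have hcol := blockCol_eq_of_eq_symmetrization hB j
  by_cases hj : i₀ = j
  · subst hj
    -- For `j = i₀` the block `C j` is zero, and by symmetry the block column `Cᵀ * B j` is `Cᵀ`
    -- itself, so the identity is a valid choice.
    refine ⟨1, ?_, fun v hv _ => by rwa [Matrix.one_mulVec] at hv⟩
    rw [hdiag, Matrix.mul_zero, add_zero] at hcol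
    rw [← hcol, Matrix.mul_one]
    exact congrArg (fun N => blockCol N i₀) hM
  obtain ⟨k, hk0, hk, hker⟩ := exists_ker_of_rank_two (hoff j hj)
  by_cases hBk : B j *ᵥ k = 0
  -- A common kernel vector kills the whole block column `j`, so its rank is below 3. By the
  -- equality of block row ranks, `Cᵀ` then has a non-zero kernel vector `w`, and adding `w kᵀ` to
  -- `B j` moves `k` off zero.
  · have hrank : (blockRow M j).rank ≠ 3 := by
      rw [← rank_blockCol hM]
      intro h3
      refine hk0 (ker_of_rank_eq_card (A := blockCol M j) h3 ?_)
      rw [hcol, Matrix.add_mulVec, ← Matrix.mulVec_mulVec, ← Matrix.mulVec_mulVec, hBk, hk,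
        Matrix.mulVec_zero, Matrix.mulVec_zero, add_zero]
    obtain ⟨w, hw, hw0⟩ : ∃ w, (blocks (block M i₀))ᵀ *ᵥ w = 0 ∧ w ≠ 0 := by
      by_contra! hcon
      rw [hrow j, ← Matrix.rank_transpose] at hrank
      exact hrank (rank_eq_card_of_ker hcon)
    refine ⟨B j + Matrix.vecMulVec w k, ?_, fun v hv hCv => ?_⟩
    · rw [Matrix.mul_add, Matrix.mul_vecMulVec, hw, Matrix.zero_vecMulVec, add_zero]
    · obtain ⟨c, rfl⟩ := hker v hCv
      rw [Matrix.add_mulVec, Matrix.mulVec_smul, hBk, smul_zero, zero_add, Matrix.mulVec_smul,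
        Matrix.vecMulVec_mulVec, smul_eq_zero] at hv
      refine hv.elim (fun hc => by rw [hc, zero_smul]) fun h => ?_
      rw [op_smul_eq_smul, smul_eq_zero, or_iff_left hw0, dotProduct_self_eq_zero] at h
      exact absurd h hk0
  · refine ⟨B j, rfl, fun v hv hCv => ?_⟩
    obtain ⟨c, rfl⟩ := hker v hCv
    rw [Matrix.mulVec_smul, smul_eq_zero, or_iff_left hBk] at hv
    rw [hv, zero_smul]

/-- Conjugating the hypothesis by `A⁻¹` says that `C * A⁻¹` is antisymmetric. -/
theorem exists_skew_mul_eq {A C : Matrix (Fin 3) (Fin 3) ℝ} (hA : A.det ≠ 0)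
    (h : Cᵀ * A + Aᵀ * C = 0) : ∃ t, C = skew t * A := by
  have e1 : A * A⁻¹ = 1 := Matrix.mul_nonsing_inv _ (isUnit_det_of_ne_zero hA)
  have e2 : A⁻¹ᵀ * Aᵀ = 1 := by rw [← Matrix.transpose_mul, e1, Matrix.transpose_one]
  obtain ⟨t, ht⟩ := exists_eq_skew (A := C * A⁻¹) (by
    have h1 : A⁻¹ᵀ * (Cᵀ * A + Aᵀ * C) * A⁻¹ =
        A⁻¹ᵀ * Cᵀ * (A * A⁻¹) + A⁻¹ᵀ * Aᵀ * (C * A⁻¹) := by noncomm_ring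
    rw [h, e1, e2, Matrix.mul_zero, Matrix.zero_mul, Matrix.mul_one, Matrix.one_mul] at h1
    rw [Matrix.transpose_mul, ← h1])
  exact ⟨t, by rw [← ht, Matrix.mul_assoc, Matrix.nonsing_inv_mul _ (isUnit_det_of_ne_zero hA),
    Matrix.mul_one]⟩

theorem exists_eq_modelMatrix {M : Matrix (Fin n × Fin 3) (Fin n × Fin 3) ℝ} (hM : Mᵀ = M)
    (hdiag : ∀ i, block M i i = 0) (hoff : ∀ i j, i ≠ j → (block M i j).rank = 2) (i₀ : Fin n)
    (hrow : ∀ j, (blockRow M j).rank = (blockRow M i₀).rank)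
    (hr : M.rank = 2 * (blockRow M i₀).rank) :
    ∃ B t, (∀ i, (B i).det ≠ 0) ∧ M = modelMatrix B t := by
  obtain ⟨B₀, hB₀⟩ := exists_blocks_symmetrization hM i₀ (hdiag i₀) hr
  choose B hB hinj using exists_lift hM (hdiag i₀) (hoff i₀) hrow hB₀
  set C := block M i₀ with hC
  have hMB : M = (blocks C)ᵀ * blocks B + (blocks B)ᵀ * blocks C := by
    have h1 := mul_blocks_congr hB
    have h2 := congrArg Matrix.transpose h1
    rw [Matrix.transpose_mul, Matrix.transpose_mul, Matrix.transpose_transpose] at h2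
    rw [h1, h2]
    exact hB₀
  have hdiagB : ∀ j, (C j)ᵀ * B j + (B j)ᵀ * C j = 0 := fun j => by
    rw [← eq_block_of_eq_symmetrization hMB, hdiag]
  obtain ⟨s, hs⟩ := exists_common_det_sub_skew_mul_ne_zero B C (fun j => by
    by_cases hj : i₀ = j
    · refine ⟨0, det_ne_zero_of_ker fun v hv => hinj j v ?_ ?_⟩
      · rwa [hC, ← hj, hdiag, Matrix.mul_zero, sub_zero, hj] at hv
      · rw [hC, ← hj, hdiag, Matrix.zero_mulVec]
    · exact exists_det_sub_skew_mul_ne_zero (hoff i₀ j hj) (hdiagB j) (hinj j))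
  -- The two extra terms `∓ (C i)ᵀ * skew s * C j` cancel, so a common shift by `skew s` does not
  -- change `M`.
  have hblock : ∀ i j, block M i j =
      (C i)ᵀ * (B j - skew s * C j) + (B i - skew s * C i)ᵀ * C j := fun i j => by
    rw [eq_block_of_eq_symmetrization hMB, Matrix.transpose_sub, Matrix.transpose_mul,
      skew_transpose]
    noncomm_ring
  -- The zero diagonal blocks supply the centers: `C j = skew (t j) * (B j - skew s * C j)`.
  choose t ht using fun j => exists_skew_mul_eq (hs j) (by rw [← hblock, hdiag])
  refine ⟨fun j => B j - skew s * C j, t, hs, ?_⟩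
  ext p q
  refine (congrFun (congrFun (hblock p.1 q.1) p.2) q.2).trans ?_
  rw [modelMatrix, Matrix.of_apply]
  refine congrFun (congrFun ?_ p.2) q.2
  generalize hX : (fun j => B j - skew s * C j) = X at *
  have hX' : ∀ j, B j - skew s * C j = X j := fun j => congrFun hX j
  simp only [hX'] at ht ⊢
  rw [ht p.1, ht q.1, Matrix.transpose_mul, skew_transpose, skew_sub]
  noncomm_ring

end Reconstruction

/-! ### Applying the reconstruction to the n-view matrix -/

section Main

variable {n : ℕ} {F : Fin n → Fin n → Matrix (Fin 3) (Fin 3) ℝ}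

theorem nViewMatrix_transpose (hF : IsFundamentalFamily F) {s : Fin n → Fin n → ℝ}
    (hs : IsScaling s) : (nViewMatrix s F)ᵀ = nViewMatrix s F := by
  ext p q
  by_cases h : p.1 = q.1
  · simp [nViewMatrix, h]
  · simp [nViewMatrix, h, Ne.symm h, hs.symm p.1 q.1 h, ← hF.transpose_eq p.1 q.1 h]

theorem block_nViewMatrix (s : Fin n → Fin n → ℝ) (i j : Fin n) :
    block (nViewMatrix s F) i j = if i = j then 0 else s i j • F i j := by
  ext a b
  by_cases h : i = j <;> simp [block, nViewMatrix, h]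

/-- Serves both cases at once: `4 = 2 * 2` and `6 = 2 * 3`. -/
theorem exists_isModel_of_rank (hF : IsFundamentalFamily F) {s : Fin n → Fin n → ℝ}
    (hs : IsScaling s) {r : ℕ} (i₀ : Fin n) (hr : (nViewMatrix s F).rank = 2 * r)
    (hrow : ∀ i, (blockRow (nViewMatrix s F) i).rank = r) :
    ∃ B t, IsModel F B t ∧ nViewMatrix s F = modelMatrix B t := by
  obtain ⟨B, t, hB, h⟩ := exists_eq_modelMatrix (nViewMatrix_transpose hF hs)
    (fun i => by rw [block_nViewMatrix, if_pos rfl])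
    (fun i j hij => by
      rw [block_nViewMatrix, if_neg hij, Matrix.rank_smul_of_mem_nonZeroDivisors _
        (mem_nonZeroDivisors_of_ne_zero (hs.ne_zero i j hij)), hF.rank_eq i j hij])
    i₀ (fun j => by rw [hrow, hrow]) (by rw [hr, hrow])
  refine ⟨B, t, ⟨hB, fun i j hij => ⟨(s i j)⁻¹, inv_ne_zero (hs.ne_zero i j hij), ?_⟩⟩, h⟩
  have h1 := block_nViewMatrix (F := F) s i j
  rw [if_neg hij, h] at h1
  rw [eq_inv_smul_iff₀ (hs.ne_zero i j hij), ← h1]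
  rfl

end Main

end NView

theorem mainTheorem4 (n : ℕ) (hn : 3 ≤ n) (F : Fin n → Fin n → Matrix (Fin 3) (Fin 3) ℝ)
    (hF : NView.IsFundamentalFamily F) :
    ((∃ P : Fin n → Matrix (Fin 3) (Fin 4) ℝ,
        NView.IsSolution F P ∧ NView.OnALine (fun i => NView.center (P i))) ↔
      ∃ s : Fin n → Fin n → ℝ, NView.IsScaling s ∧
        (NView.nViewMatrix s F).rank = 4 ∧
        (∀ i, (NView.blockRow (NView.nViewMatrix s F) i).rank = 2) ∧
        (∀ j, (NView.blockCol (NView.nViewMatrix s F) j).rank = 2)) ∧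
    (NView.NoThreeEpipolesOnALine F →
      ((∃ P : Fin n → Matrix (Fin 3) (Fin 4) ℝ,
          NView.IsSolution F P ∧ ¬ NView.OnALine (fun i => NView.center (P i))) ↔
        ∃ s : Fin n → Fin n → ℝ, NView.IsScaling s ∧
          (NView.nViewMatrix s F).rank = 6 ∧
          (∀ i, (NView.blockRow (NView.nViewMatrix s F) i).rank = 3) ∧
          (∀ j, (NView.blockCol (NView.nViewMatrix s F) j).rank = 3))) := by
  refine ⟨⟨?_, ?_⟩, fun _ => ⟨?_, ?_⟩⟩
  · rintro ⟨P, hP, hline⟩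
    obtain ⟨B, t, hBt, hiff⟩ := hP.exists_isModel hn hF
    obtain ⟨s, hs, hsM⟩ := hBt.exists_isScaling hF
    obtain ⟨h1, h2⟩ := hBt.exists_rank_of_collinear hn hF (hiff.1 hline)
    refine ⟨s, hs, ?_⟩
    rw [hsM]
    exact ⟨h1, h2, fun j => by rw [NView.rank_blockCol (NView.modelMatrix_transpose B t), h2]⟩
  · rintro ⟨s, hs, hr, hrow, -⟩
    obtain ⟨B, t, hBt, hM⟩ := NView.exists_isModel_of_rank hF hs ⟨0, by omega⟩ hr hrow
    obtain ⟨P, hP, hiff⟩ := hBt.exists_isSolution hn hF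
    refine ⟨P, hP, hiff.2 ?_⟩
    -- Non-collinear centers would give rank 6 instead of 4.
    by_contra hcol
    have := NView.rank_modelMatrix_of_not_collinear hBt.det_ne_zero hcol ⟨0, by omega⟩
    rw [← hM] at this
    omega
  · rintro ⟨P, hP, hline⟩
    obtain ⟨B, t, hBt, hiff⟩ := hP.exists_isModel hn hF
    obtain ⟨s, hs, hsM⟩ := hBt.exists_isScaling hF
    have hcol : ¬ Collinear ℝ (Set.range t) := fun h => hline (hiff.2 h)
    have h2 := NView.rank_blockRow_modelMatrix_of_not_collinear hBt.det_ne_zero hcol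
    refine ⟨s, hs, ?_⟩
    rw [hsM]
    exact ⟨NView.rank_modelMatrix_of_not_collinear hBt.det_ne_zero hcol ⟨0, by omega⟩, h2,
      fun j => by rw [NView.rank_blockCol (NView.modelMatrix_transpose B t), h2]⟩
  · rintro ⟨s, hs, hr, hrow, -⟩
    obtain ⟨B, t, hBt, hM⟩ := NView.exists_isModel_of_rank hF hs ⟨0, by omega⟩ hr hrow
    obtain ⟨P, hP, hiff⟩ := hBt.exists_isSolution hn hF
    refine ⟨P, hP, fun hline => ?_⟩
    -- Collinear centers would give rank 4 instead of 6.
    have := (hBt.exists_rank_of_collinear hn hF (hiff.1 hline)).1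
    rw [← hM] at this
    omega
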